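/- For a negative discriminant $D$, let $C(D)$ be the class group of primitive positive definite integral binary quadratic forms of discriminant $D$ modulo $\mathrm{SL}_2(\mathbb{Z})$, with Dirichlet composition, and for a positive integer $m$ let $e\in C(-4m)$ denote the identity element, the class of $x^2+my^2$. For a positive integer $s$, a class $F\in C(Ds^2)$ is said to be derived from a class $G\in C(D)$ if there are forms $f$ in $F$ and $g$ in $G$ and an integer $2\times 2$ matrix $A$ with $\det A=s$ such that $f(x,y)=g(A\cdot(x,y)^T)$. For a positive integer $r=\prod_i p_i^{e_i}$ put $\varphi_D(r)=\prod_i p_i^{e_i-1}\left(p_i-\left(\frac{D}{p_i}\right)\right)$, where $\left(\frac{D}{p}\right)$ is the Kronecker symbol. Let $a,b$ be positive integers, $n=a^2b$, and let $g\in C(-4n)$ be derived from $e\in C(-4b)$. Let $r$ be a positive integer with $\gcd(r,a)=1$, and let $h\in C(-4nr^2)$ be any lift of $g$, that is, any class derived from $g$. Then $l=h^{\varphi_{-4n}(r)}\in C(-4nr^2)$ is derived both from $e\in C(-4b)$ and from $e\in C(-4br^2)$. -/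

import Mathlib

/-- The integral binary quadratic form `a x² + b x y + c y²`. -/
@[ext]
structure BQF where
  a : ℤ
  b : ℤ
  c : ℤ

namespace BQF

/-- The value `f(x, y)`. -/
def eval (f : BQF) (x y : ℤ) : ℤ := f.a * x ^ 2 + f.b * x * y + f.c * y ^ 2

/-- The discriminant `b² - 4ac`. -/
def disc (f : BQF) : ℤ := f.b ^ 2 - 4 * f.a * f.c

/-- `f` is primitive: `gcd(a, b, c) = 1`. -/
def Primitive (f : BQF) : Prop := Int.gcd f.a (Int.gcd f.b f.c) = 1

/-- `f` is positive definite. -/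
def PosDef (f : BQF) : Prop := ∀ x y : ℤ, (x ≠ 0 ∨ y ≠ 0) → 0 < f.eval x y

/-- The form `(x, y) ↦ f (A (x, y)ᵀ)`, for a `2 × 2` integer matrix `A`. -/
def transform (f : BQF) (A : Matrix (Fin 2) (Fin 2) ℤ) : BQF where
  a := f.eval (A 0 0) (A 1 0)
  b := 2 * f.a * A 0 0 * A 0 1 + f.b * (A 0 0 * A 1 1 + A 0 1 * A 1 0) + 2 * f.c * A 1 0 * A 1 1
  c := f.eval (A 0 1) (A 1 1)

theorem eval_transform (f : BQF) (A : Matrix (Fin 2) (Fin 2) ℤ) (x y : ℤ) :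
    (f.transform A).eval x y = f.eval (A 0 0 * x + A 0 1 * y) (A 1 0 * x + A 1 1 * y) := by
  simp only [transform, eval]; ring

theorem transform_one (f : BQF) : f.transform 1 = f := by
  ext <;> simp [transform, eval]

theorem transform_mul (f : BQF) (A B : Matrix (Fin 2) (Fin 2) ℤ) :
    f.transform (A * B) = (f.transform A).transform B := by
  ext <;> simp only [transform, eval, Matrix.mul_apply, Fin.sum_univ_two] <;> ring

theorem disc_transform (f : BQF) (A : Matrix (Fin 2) (Fin 2) ℤ) :
    (f.transform A).disc = f.disc * A.det ^ 2 := by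
  simp only [transform, eval, disc, Matrix.det_fin_two]; ring

theorem primitive_iff (f : BQF) :
    f.Primitive ↔ ∀ p : ℕ, p.Prime → ¬ ((p : ℤ) ∣ f.a ∧ (p : ℤ) ∣ f.b ∧ (p : ℤ) ∣ f.c) := by
  unfold Primitive
  rw [Nat.eq_one_iff_not_exists_prime_dvd]
  refine forall_congr' fun p => forall_congr' fun _ => not_congr ?_
  rw [← Int.natCast_dvd_natCast, Int.dvd_coe_gcd_iff, Int.dvd_coe_gcd_iff]

theorem Primitive.transform {f : BQF} (hf : f.Primitive) (A : Matrix.SpecialLinearGroup (Fin 2) ℤ) :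
    (f.transform A.1).Primitive := by
  rw [primitive_iff] at hf ⊢
  rintro p hp ⟨h1, h2, h3⟩
  apply hf p hp
  have key : f = (f.transform A.1).transform (A⁻¹).1 := by
    rw [← transform_mul, ← Matrix.SpecialLinearGroup.coe_mul, mul_inv_cancel]
    exact (transform_one f).symm
  rw [key]
  generalize f.transform A.1 = g at h1 h2 h3
  obtain ⟨s, hs⟩ := h1
  obtain ⟨t, ht⟩ := h2
  obtain ⟨u, hu⟩ := h3
  simp only [BQF.transform, eval, hs, ht, hu]
  generalize (A⁻¹).1 = M
  refine ⟨⟨s * M 0 0 ^ 2 + t * M 0 0 * M 1 0 + u * M 1 0 ^ 2, by ring⟩,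
    ⟨2 * s * M 0 0 * M 0 1 + t * (M 0 0 * M 1 1 + M 0 1 * M 1 0) + 2 * u * M 1 0 * M 1 1, by ring⟩,
    ⟨s * M 0 1 ^ 2 + t * M 0 1 * M 1 1 + u * M 1 1 ^ 2, by ring⟩⟩

theorem PosDef.transform {f : BQF} (hf : f.PosDef) (A : Matrix.SpecialLinearGroup (Fin 2) ℤ) :
    (f.transform A.1).PosDef := by
  intro x y hxy
  rw [eval_transform]
  apply hf
  by_contra! h
  obtain ⟨h1, h2⟩ := h
  have hd := A.2
  rw [Matrix.det_fin_two] at hd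
  have hx : x = 0 := by linear_combination -x * hd + A.1 1 1 * h1 - A.1 0 1 * h2
  have hy : y = 0 := by linear_combination -y * hd - A.1 1 0 * h1 + A.1 0 0 * h2
  rcases hxy with h | h
  · exact h hx
  · exact h hy

theorem PosDef.a_pos {f : BQF} (hf : f.PosDef) : 0 < f.a := by
  have := hf 1 0 (by simp)
  simpa [eval] using this

theorem PosDef.disc_neg {f : BQF} (hf : f.PosDef) : f.disc < 0 := by
  have ha := hf.a_pos
  have h := hf (-f.b) (2 * f.a) (Or.inr (by omega))
  have e : f.eval (-f.b) (2 * f.a) = f.a * -f.disc := by simp only [eval, disc]; ring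
  rw [e] at h
  have := pos_of_mul_pos_right h ha.le
  linarith

theorem posDef_of {f : BQF} (ha : 0 < f.a) (hd : f.disc < 0) : f.PosDef := by
  intro x y hxy
  have e : 4 * f.a * f.eval x y = (2 * f.a * x + f.b * y) ^ 2 + (-f.disc) * y ^ 2 := by
    simp only [eval, disc]; ring
  have hpos : 0 < 4 * f.a * f.eval x y := by
    rw [e]
    have ha0 : f.a ≠ 0 := ha.ne'
    by_cases hy : y = 0
    · subst hy
      have hx : x ≠ 0 := by simpa using hxy
      have : 2 * f.a * x + f.b * 0 ≠ 0 := by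
        simp [hx, ha0]
      have h2 := sq_pos_of_ne_zero this
      simpa using h2
    · have : 0 < -f.disc := by linarith
      positivity
  exact pos_of_mul_pos_right hpos (by positivity)

end BQF

/-- The primitive positive definite binary quadratic forms of discriminant `D`. -/
abbrev PForm (D : ℤ) : Type := {f : BQF // f.disc = D ∧ f.Primitive ∧ f.PosDef}

namespace PForm

/-- `f ∼ g` if `f(x, y) = g(A (x, y)ᵀ)` for some `A ∈ SL₂(ℤ)`. -/
instance setoid (D : ℤ) : Setoid (PForm D) where
  r f g := ∃ A : Matrix.SpecialLinearGroup (Fin 2) ℤ, f.1 = g.1.transform A.1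
  iseqv :=
    { refl := fun f => ⟨1, (BQF.transform_one f.1).symm⟩
      symm := by
        rintro f g ⟨A, hA⟩
        refine ⟨A⁻¹, ?_⟩
        rw [hA, ← BQF.transform_mul, ← Matrix.SpecialLinearGroup.coe_mul, mul_inv_cancel]
        exact (BQF.transform_one g.1).symm
      trans := by
        rintro f g k ⟨A, hA⟩ ⟨B, hB⟩
        refine ⟨B * A, ?_⟩
        rw [hA, hB, ← BQF.transform_mul, ← Matrix.SpecialLinearGroup.coe_mul] }

/-- `k` is a Dirichlet composition of `f` and `g`: one has `gcd(a₁, a₂, (b₁ + b₂)/2) = 1` and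
`k = (a₁a₂, B, (B² - D)/(4a₁a₂))`, where `B ≡ b₁ mod 2a₁`, `B ≡ b₂ mod 2a₂`
and `B² ≡ D mod 4a₁a₂`. (The last congruence, and the value of the third coefficient of `k`, are
expressed by `k` having discriminant `D`; the sum `b₁ + b₂` is even as `b₁ ≡ D ≡ b₂ mod 2`.) -/
def IsDirichletComposition {D : ℤ} (f g k : PForm D) : Prop :=
  Int.gcd f.1.a (Int.gcd g.1.a ((f.1.b + g.1.b) / 2)) = 1 ∧
    k.1.a = f.1.a * g.1.a ∧
    k.1.b ≡ f.1.b [ZMOD 2 * f.1.a] ∧ k.1.b ≡ g.1.b [ZMOD 2 * g.1.a]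

end PForm

/-- A primitive form properly represents an integer coprime to any given `M ≠ 0`. -/
theorem BQF.Primitive.exists_coprime {f : BQF} (hf : f.Primitive) (M : ℤ) (hM : M ≠ 0) :
    ∃ x y : ℤ, IsCoprime x y ∧ IsCoprime (f.eval x y) M := by
  classical
  rw [BQF.primitive_iff] at hf
  set S := M.natAbs.primeFactors with hS
  set X := S.filter (fun p : ℕ => (p : ℤ) ∣ f.a ∧ ¬ (p : ℤ) ∣ f.c) with hX
  set Y := S.filter (fun p : ℕ => ¬ (p : ℤ) ∣ f.a) with hY
  have hprime : ∀ p ∈ S, p.Prime := fun p hp => Nat.prime_of_mem_primeFactors hp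
  have hdvd : ∀ T ⊆ S, ∀ p : ℕ, p.Prime → ((p : ℤ) ∣ ((∏ q ∈ T, q : ℕ) : ℤ) ↔ p ∈ T) := by
    intro T hT p hp
    rw [Int.natCast_dvd_natCast, Prime.dvd_finsetProd_iff hp.prime]
    constructor
    · rintro ⟨q, hq, hpq⟩
      rwa [(Nat.prime_dvd_prime_iff_eq hp (hprime q (hT hq))).1 hpq]
    · intro h
      exact ⟨p, h, dvd_rfl⟩
  have hXS : X ⊆ S := Finset.filter_subset _ _
  have hYS : Y ⊆ S := Finset.filter_subset _ _
  refine ⟨((∏ q ∈ X, q : ℕ) : ℤ), ((∏ q ∈ Y, q : ℕ) : ℤ), ?_, ?_⟩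
  · rw [Nat.isCoprime_iff_coprime]
    refine Nat.coprime_of_dvd fun p hp h1 h2 => ?_
    have h1' := (hdvd X hXS p hp).1 (Int.natCast_dvd_natCast.2 h1)
    have h2' := (hdvd Y hYS p hp).1 (Int.natCast_dvd_natCast.2 h2)
    rw [hX, Finset.mem_filter] at h1'
    rw [hY, Finset.mem_filter] at h2'
    exact h2'.2 h1'.2.1
  · rw [Int.isCoprime_iff_gcd_eq_one, Nat.eq_one_iff_not_exists_prime_dvd]
    intro p hp h
    have hpi : Prime (p : ℤ) := Nat.prime_iff_prime_int.1 hp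
    rw [← Int.natCast_dvd_natCast, Int.dvd_coe_gcd_iff] at h
    obtain ⟨h1, h2⟩ := h
    have hpS : p ∈ S := Nat.mem_primeFactors.2
      ⟨hp, Int.natCast_dvd.1 h2, Int.natAbs_ne_zero.2 hM⟩
    have hx := hdvd X hXS p hp
    have hy := hdvd Y hYS p hp
    generalize ((∏ q ∈ X, q : ℕ) : ℤ) = x at h1 hx
    generalize ((∏ q ∈ Y, q : ℕ) : ℤ) = y at h1 hy
    rw [hX, Finset.mem_filter] at hx
    rw [hY, Finset.mem_filter] at hy
    have hp2 : ∀ z : ℤ, (p : ℤ) ∣ z ^ 2 → (p : ℤ) ∣ z := fun z => hpi.dvd_of_dvd_pow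
    unfold BQF.eval at h1
    by_cases ha : (p : ℤ) ∣ f.a
    · have hy' : ¬ (p : ℤ) ∣ y := fun h => (hy.1 h).2 ha
      by_cases hc : (p : ℤ) ∣ f.c
      · have hx' : ¬ (p : ℤ) ∣ x := fun h => (hx.1 h).2.2 hc
        have h3 : (p : ℤ) ∣ f.b * x * y := by
          have := dvd_sub h1 (dvd_add (ha.mul_right (x ^ 2)) (hc.mul_right (y ^ 2)))
          ring_nf at this ⊢
          exact this
        rcases hpi.dvd_or_dvd h3 with h3 | h3
        · rcases hpi.dvd_or_dvd h3 with h3 | h3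
          · exact hf p hp ⟨ha, h3, hc⟩
          · exact hx' h3
        · exact hy' h3
      · have hx' : (p : ℤ) ∣ x := hx.2 ⟨hpS, ha, hc⟩
        have h3 : (p : ℤ) ∣ f.c * y ^ 2 := by
          have := dvd_sub h1 (dvd_add (ha.mul_right (x ^ 2)) (hx'.mul_left (f.b * y)))
          ring_nf at this ⊢
          exact this
        rcases hpi.dvd_or_dvd h3 with h3 | h3
        · exact hc h3
        · exact hy' (hp2 y h3)
    · have hy' : (p : ℤ) ∣ y := hy.2 ⟨hpS, ha⟩
      have hx' : ¬ (p : ℤ) ∣ x := fun h => ha (hx.1 h).2.1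
      have h3 : (p : ℤ) ∣ f.a * x ^ 2 := by
        have := dvd_sub h1 (hy'.mul_left (f.b * x + f.c * y))
        ring_nf at this ⊢
        exact this
      rcases hpi.dvd_or_dvd h3 with h3 | h3
      · exact ha h3
      · exact hx' (hp2 x h3)

/-- Up to equivalence, any two forms of the same discriminant have a Dirichlet composition. -/
theorem PForm.exists_composition {D : ℤ} (f g : PForm D) :
    ∃ g' k : PForm D, g' ≈ g ∧ IsDirichletComposition f g' k := by
  have ha1 := f.2.2.2.a_pos
  obtain ⟨x, y, hxy, hcop⟩ := g.2.2.1.exists_coprime f.1.a ha1.ne'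
  obtain ⟨u, v, huv⟩ := hxy
  let A : Matrix.SpecialLinearGroup (Fin 2) ℤ :=
    ⟨!![x, -v; y, u], by rw [Matrix.det_fin_two_of]; linear_combination huv⟩
  let g' : PForm D := ⟨g.1.transform A.1, by
      rw [BQF.disc_transform, A.2, g.2.1]; ring, g.2.2.1.transform A, g.2.2.2.transform A⟩
  have hg'a : g'.1.a = g.1.eval x y := rfl
  have ha2 := g'.2.2.2.a_pos
  rw [← hg'a] at hcop
  have hgg : g' ≈ g := ⟨A, rfl⟩
  clear_value g'
  have hD1 : f.1.b ^ 2 - 4 * f.1.a * f.1.c = D := f.2.1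
  have hD2 : g'.1.b ^ 2 - 4 * g'.1.a * g'.1.c = D := g'.2.1
  have hDneg : D < 0 := f.2.1 ▸ f.2.2.2.disc_neg
  have hpr1 := (BQF.primitive_iff _).1 f.2.2.1
  have hpr2 := (BQF.primitive_iff _).1 g'.2.2.1
  obtain ⟨s, hs⟩ : (2 : ℤ) ∣ g'.1.b - f.1.b := by
    have h : Even ((g'.1.b - f.1.b) ^ 2) := by
      refine ⟨f.1.b ^ 2 - g'.1.b * f.1.b + 2 * (g'.1.a * g'.1.c - f.1.a * f.1.c), ?_⟩
      linear_combination hD2 - hD1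
    exact (Int.even_pow.1 h).1.two_dvd
  obtain ⟨i, j, hij⟩ := hcop
  set B := f.1.b + 2 * f.1.a * (j * s) with hB
  have hB2 : B = g'.1.b - 2 * g'.1.a * (i * s) := by
    rw [hB]; linear_combination 2 * s * hij - hs
  have hdiv : g'.1.a * f.1.a ∣ f.1.a * (f.1.c + f.1.b * (j * s) + f.1.a * (j * s) ^ 2) := by
    apply IsCoprime.mul_dvd ⟨i, j, hij⟩
    · refine ⟨g'.1.c - g'.1.b * (i * s) + g'.1.a * (i * s) ^ 2, ?_⟩
      have h4 : (4 : ℤ) * (f.1.a * (f.1.c + f.1.b * (j * s) + f.1.a * (j * s) ^ 2)) =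
          4 * (g'.1.a * (g'.1.c - g'.1.b * (i * s) + g'.1.a * (i * s) ^ 2)) := by
        have : B ^ 2 = (g'.1.b - 2 * g'.1.a * (i * s)) ^ 2 := by rw [hB2]
        rw [hB] at this
        linear_combination this - hD1 + hD2
      linarith
    · exact dvd_mul_right _ _
  obtain ⟨C, hC⟩ := hdiv
  have hkd : (BQF.mk (f.1.a * g'.1.a) B C).disc = D := by
    simp only [BQF.disc]
    rw [hB]; linear_combination hD1 + 4 * hC
  have hkpd : (BQF.mk (f.1.a * g'.1.a) B C).PosDef :=
    BQF.posDef_of (mul_pos ha1 ha2) (by rw [hkd]; exact hDneg)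
  have hkpr : (BQF.mk (f.1.a * g'.1.a) B C).Primitive := by
    rw [BQF.primitive_iff]
    rintro p hp ⟨h1, h2, h3⟩
    simp only at h1 h2 h3
    have hpi : Prime (p : ℤ) := Nat.prime_iff_prime_int.1 hp
    rcases hpi.dvd_or_dvd h1 with h | h
    · refine hpr1 p hp ⟨h, ?_, ?_⟩
      · have := dvd_sub h2 (h.mul_right (2 * (j * s)))
        have e : f.1.b = B - f.1.a * (2 * (j * s)) := by rw [hB]; ring
        rw [e]; exact this
      · have hc : f.1.c = g'.1.a * C - B * (j * s) + f.1.a * (j * s) ^ 2 := by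
          have : f.1.a * f.1.c = f.1.a * (g'.1.a * C - B * (j * s) + f.1.a * (j * s) ^ 2) := by
            rw [hB]; linear_combination hC
          exact mul_left_cancel₀ ha1.ne' this
        rw [hc]
        exact dvd_add (dvd_sub (h3.mul_left _) (h2.mul_right _)) (h.mul_right _)
    · refine hpr2 p hp ⟨h, ?_, ?_⟩
      · have : g'.1.b = B + g'.1.a * (2 * (i * s)) := by rw [hB2]; ring
        rw [this]; exact dvd_add h2 (h.mul_right _)
      · have hc : g'.1.c = f.1.a * C + B * (i * s) + g'.1.a * (i * s) ^ 2 := by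
          have : (4 * g'.1.a) * g'.1.c =
              (4 * g'.1.a) * (f.1.a * C + B * (i * s) + g'.1.a * (i * s) ^ 2) := by
            have hkd' : B ^ 2 - 4 * (f.1.a * g'.1.a) * C = D := hkd
            have hb : g'.1.b = B + g'.1.a * (2 * (i * s)) := by rw [hB2]; ring
            rw [hb] at hD2
            linear_combination hkd' - hD2
          exact mul_left_cancel₀ (by positivity) this
        rw [hc]
        exact dvd_add (dvd_add (h3.mul_left _) (h2.mul_right _)) (h.mul_right _)
  refine ⟨g', ⟨⟨f.1.a * g'.1.a, B, C⟩, hkd, hkpr, hkpd⟩, hgg, ?_, rfl, ?_, ?_⟩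
  · have h1 : Int.gcd f.1.a g'.1.a = 1 := Int.isCoprime_iff_gcd_eq_one.1 ⟨j, i, by
      linear_combination hij⟩
    have h2 : Int.gcd f.1.a (Int.gcd g'.1.a ((f.1.b + g'.1.b) / 2)) ∣ Int.gcd f.1.a g'.1.a :=
      Int.dvd_gcd (Int.gcd_dvd_left _ _) ((Int.gcd_dvd_right _ _).trans (Int.gcd_dvd_left _ _))
    rw [h1] at h2
    exact Nat.dvd_one.1 h2
  · exact (Int.modEq_iff_dvd.2 ⟨j * s, by simp only [hB]; ring⟩ : f.1.b ≡ B [ZMOD _]).symm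
  · exact Int.modEq_iff_dvd.2 ⟨i * s, by linear_combination -hB2⟩

/-- The underlying set of the class group `C(D)`, for a negative discriminant `D`: the
`SL₂(ℤ)`-equivalence classes of primitive positive definite forms of discriminant `D`. -/
def FormClass (D : ℤ) : Type := Quotient (PForm.setoid D)

namespace FormClass

/-- The class of a form. -/
def mk {D : ℤ} (f : PForm D) : FormClass D := Quotient.mk _ f

/-- `K` contains a Dirichlet composition of a form in `F` and a form in `G`. -/
def IsComposition {D : ℤ} (F G K : FormClass D) : Prop :=
  ∃ f g k : PForm D, mk f = F ∧ mk g = G ∧ mk k = K ∧ PForm.IsDirichletComposition f g k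

theorem exists_isComposition {D : ℤ} (F G : FormClass D) : ∃ K, IsComposition F G K := by
  induction F using Quotient.inductionOn with | _ f => ?_
  induction G using Quotient.inductionOn with | _ g => ?_
  obtain ⟨g', k, hg, hk⟩ := f.exists_composition g
  exact ⟨mk k, f, g', k, rfl, Quotient.sound hg, rfl, hk⟩

/-- The group operation of `C(D)`: composition of classes, that is, the class of the Dirichlet
composition of representatives. -/
noncomputable instance (D : ℤ) : Mul (FormClass D) :=
  ⟨fun F G => (exists_isComposition F G).choose⟩

theorem mul_isComposition {D : ℤ} (F G : FormClass D) : IsComposition F G (F * G) :=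
  (exists_isComposition F G).choose_spec

/-- The identity element `e = (1, 0, m)` of `C(-4m)`. -/
def e (m : ℕ+) : FormClass (-4 * (m : ℤ)) :=
  mk ⟨⟨1, 0, m⟩, by simp [BQF.disc], by simp [BQF.Primitive],
    BQF.posDef_of (by simp) (by simp [BQF.disc])⟩

/-- Powers in the class group `C(-4m)`: `F ^ 0 = e` and `F ^ (k + 1) = F ^ k * F`. -/
noncomputable def pow {m : ℕ+} (F : FormClass (-4 * (m : ℤ))) : ℕ → FormClass (-4 * (m : ℤ))
  | 0 => e m
  | k + 1 => pow F k * F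

/-- `F ∈ C(D')` is derived from `G ∈ C(D)` by a transformation of determinant `r`: there are forms
`f` in `F` and `g` in `G` and an integer matrix `A` of determinant `r` such that
`f(x, y) = g(A (x, y)ᵀ)`. (This forces `D' = D r²`.) -/
def IsDerived {D' D : ℤ} (r : ℤ) (F : FormClass D') (G : FormClass D) : Prop :=
  ∃ (f : PForm D') (g : PForm D) (A : Matrix (Fin 2) (Fin 2) ℤ),
    mk f = F ∧ mk g = G ∧ A.det = r ∧ f.1 = g.1.transform A

end FormClass

/-- The Kronecker symbol `(D / p)` for a prime number `p`. For `p = 2` it is `0` if `D` is even,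
`1` if `D ≡ ±1 mod 8` and `-1` if `D ≡ ±3 mod 8`; for odd `p` it is the Legendre symbol. -/
def kroneckerPrime (D : ℤ) (p : ℕ) : ℤ :=
  if p = 2 then ZMod.χ₈ (D : ZMod 8) else jacobiSym D p

/-- `φ_D(r) = ∏ pᵢ ^ (eᵢ - 1) (pᵢ - (D / pᵢ))` for `r = ∏ pᵢ ^ eᵢ`. (All factors are positive.) -/
def phi (D : ℤ) (r : ℕ) : ℕ :=
  ∏ p ∈ r.primeFactors, p ^ (r.factorization p - 1) * ((p : ℤ) - kroneckerPrime D p).toNat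

open Zsqrtd

/-! A class derived from the identity of `C(-4b)` by determinant `N` is the class of the norm form
of a lattice of index `N` in `𝒪 = ℤ[√-b]`, and Dirichlet composition is multiplication of lattices.
Suppose `r ∣ N`. A lattice of index `N` containing some `ξ` of norm prime to `r` lies in `ℤξ + r𝒪`,
so its `k`-th power lies in `ℤξᵏ + r𝒪`. The group `(𝒪/r𝒪)ˣ / (ℤ/rℤ)ˣ` is killed by
`φ_{-4b}(r)`; for this `k`, therefore, `ξᵏ` and the whole power of the lattice lie in the order
`ℤ + r𝒪 ≅ ℤ[√(-br²)]`, whose own norm form is the identity of `C(-4br²)`. Finally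
`φ_{-4a²b}(r) = φ_{-4b}(r)` when `a` is prime to `r`. -/

section Kronecker

theorem kroneckerPrime_sq_mul {c : ℤ} {p : ℕ} (h : IsCoprime c p) (D : ℤ) :
    kroneckerPrime (c ^ 2 * D) p = kroneckerPrime D p := by
  unfold kroneckerPrime
  split_ifs with hp
  · subst hp
    have hc : IsUnit (c : ZMod 8) :=
      (ZMod.coe_int_isUnit_iff_isCoprime c 8).2 (by simpa using (h.pow_right (n := 3)).symm)
    have hsq : ZMod.χ₈ c ^ 2 = 1 := by
      rw [← MulChar.pow_apply' _ two_ne_zero, ZMod.isQuadratic_χ₈.sq_eq_one, MulChar.one_apply hc]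
    rw [Int.cast_mul, Int.cast_pow, map_mul, map_pow, hsq, one_mul]
  · rw [jacobiSym.mul_left, jacobiSym.sq_one' (Int.isCoprime_iff_gcd_eq_one.1 h), one_mul]

theorem kroneckerPrime_four_mul_two (d : ℤ) : kroneckerPrime (4 * d) 2 = 0 := by
  have h : ∀ x : ZMod 8, ZMod.χ₈ (4 * x) = 0 := by decide
  simpa [kroneckerPrime] using h d

theorem kroneckerPrime_four_mul {p : ℕ} [Fact p.Prime] (hp : p ≠ 2) (d : ℤ) :
    kroneckerPrime (4 * d) p = legendreSym p d := by
  have h2 : IsCoprime (2 : ℤ) p := by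
    exact_mod_cast (Nat.coprime_primes Nat.prime_two Fact.out).2 hp.symm
  rw [show (4 : ℤ) * d = 2 ^ 2 * d by ring, kroneckerPrime_sq_mul h2, kroneckerPrime, if_neg hp,
    jacobiSym.legendreSym.to_jacobiSym]

theorem phi_sq_mul {c : ℤ} {r : ℕ} (h : IsCoprime c r) (D : ℤ) : phi (c ^ 2 * D) r = phi D r := by
  refine Finset.prod_congr rfl fun p hp => ?_
  have hpr : (p : ℤ) ∣ r := Int.natCast_dvd_natCast.2 (Nat.dvd_of_mem_primeFactors hp)
  rw [kroneckerPrime_sq_mul (h.of_isCoprime_of_dvd_right hpr)]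

theorem dvd_phi_of_prime_pow_dvd (D : ℤ) {p r k : ℕ} (hp : p.Prime) (hr : r ≠ 0)
    (h : p ^ (k + 1) ∣ r) : p ^ k * ((p : ℤ) - kroneckerPrime D p).toNat ∣ phi D r := by
  have hk : k ≤ r.factorization p - 1 :=
    Nat.le_sub_one_of_lt ((hp.pow_dvd_iff_le_factorization hr).1 h)
  have hpr : p ∈ r.primeFactors :=
    Nat.mem_primeFactors.2 ⟨hp, (dvd_pow_self p k.succ_ne_zero).trans h, hr⟩
  exact (mul_dvd_mul_right (pow_dvd_pow p hk) _).trans (Finset.dvd_prod_of_mem _ hpr)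

end Kronecker

section ConductorOrder

variable {d : ℤ}

/-- The order `ℤ + r ℤ[√d]` of conductor `r` in `ℤ[√d]`, encoded as the elements whose coefficient
at `√d` is divisible by `r`. -/
def conductorOrder (d r : ℤ) : Subring (ℤ√d) where
  carrier := {z | r ∣ z.im}
  mul_mem' {z w} hz hw := by
    rw [Set.mem_ofPred_eq, im_mul]
    exact dvd_add (hw.mul_left _) (hz.mul_right _)
  one_mem' := dvd_zero r
  add_mem' hz hw := dvd_add hz hw
  zero_mem' := dvd_zero r
  neg_mem' hz := (dvd_neg (α := ℤ)).2 hz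

theorem mem_conductorOrder {r : ℤ} {z : ℤ√d} : z ∈ conductorOrder d r ↔ r ∣ z.im :=
  Iff.rfl

theorem mem_conductorOrder_iff_exists_dvd_sub {r : ℤ} {z : ℤ√d} :
    z ∈ conductorOrder d r ↔ ∃ x : ℤ, (r : ℤ√d) ∣ z - x := by
  simp only [mem_conductorOrder, intCast_dvd, re_sub, im_sub, re_intCast, im_intCast, sub_zero]
  exact ⟨fun h => ⟨z.re, by simp, h⟩, fun ⟨_, _, h⟩ => h⟩

theorem isCoprime_intCast_of_isCoprime_norm {r : ℤ} {z : ℤ√d} (h : IsCoprime z.norm r) :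
    IsCoprime (r : ℤ√d) z := by
  have h' := h.intCast (R := ℤ√d)
  rw [norm_eq_mul_conj] at h'
  exact h'.of_mul_left_left.symm

theorem pow_pow_mem_conductorOrder {p : ℕ} {z : ℤ√d} (hz : z ∈ conductorOrder d p) (k : ℕ) :
    z ^ p ^ k ∈ conductorOrder d ((p ^ (k + 1) : ℕ) : ℤ) := by
  obtain ⟨x, hx⟩ := mem_conductorOrder_iff_exists_dvd_sub.1 hz
  refine mem_conductorOrder_iff_exists_dvd_sub.2 ⟨x ^ p ^ k, ?_⟩
  exact_mod_cast dvd_sub_pow_of_dvd_sub (by exact_mod_cast hx : (p : ℤ√d) ∣ z - x) k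

theorem sq_mem_conductorOrder_two (z : ℤ√d) : z ^ 2 ∈ conductorOrder d 2 :=
  ⟨z.re * z.im, by rw [sq, im_mul]; ring⟩

theorem sqrtd_pow_of_odd {k : ℕ} (hk : Odd k) :
    (sqrtd : ℤ√d) ^ k = ((d ^ (k / 2) : ℤ) : ℤ√d) * sqrtd := by
  conv_lhs => rw [← Nat.two_mul_div_two_add_one_of_odd hk]
  rw [pow_succ, pow_mul, sq, dmuld, Int.cast_pow]

/-- Frobenius fixes or conjugates `√d`, by Euler's criterion. -/
theorem dvd_pow_sub_legendreSym_mul_im {p : ℕ} [hp : Fact p.Prime] (hp2 : p ≠ 2) (z : ℤ√d) :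
    (p : ℤ√d) ∣ z ^ p - ⟨z.re, legendreSym p d * z.im⟩ := by
  have hre : (p : ℤ) ∣ z.re ^ p - z.re := by
    rw [← ZMod.intCast_eq_intCast_iff_dvd_sub, Int.cast_pow, ZMod.pow_card]
  have him : (p : ℤ) ∣ z.im ^ p * d ^ (p / 2) - legendreSym p d * z.im := by
    rw [← ZMod.intCast_eq_intCast_iff_dvd_sub]
    push_cast
    rw [ZMod.pow_card, legendreSym.eq_pow, mul_comm]
  obtain ⟨η, hη⟩ := exists_add_pow_prime_eq hp.out (z.re : ℤ√d) ((sqrtd : ℤ√d) * (z.im : ℤ√d))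
  rw [← decompose, mul_pow, sqrtd_pow_of_odd (hp.out.odd_of_ne_two hp2)] at hη
  have hdiff : z ^ p - ⟨z.re, legendreSym p d * z.im⟩ = ((z.re ^ p - z.re : ℤ) : ℤ√d) +
      ((z.im ^ p * d ^ (p / 2) - legendreSym p d * z.im : ℤ) : ℤ√d) * sqrtd +
      (p : ℤ√d) * ((z.re : ℤ√d) * ((sqrtd : ℤ√d) * (z.im : ℤ√d)) * η) := by
    rw [decompose]
    push_cast at hη ⊢
    linear_combination hη
  rw [hdiff]
  have hcast {x : ℤ} (h : (p : ℤ) ∣ x) : (p : ℤ√d) ∣ x := by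
    exact_mod_cast (intCast_dvd_intCast (d := d) p x).2 h
  exact dvd_add (dvd_add (hcast hre) ((hcast him).mul_right _)) (dvd_mul_right _ _)

theorem pow_sub_legendreSym_mem_conductorOrder {p : ℕ} [hp : Fact p.Prime] (hp2 : p ≠ 2) {z : ℤ√d}
    (hz : IsCoprime z.norm p) : z ^ ((p : ℤ) - legendreSym p d).toNat ∈ conductorOrder d p := by
  have hfrob := dvd_pow_sub_legendreSym_mul_im hp2 z
  suffices ∃ x : ℤ, (p : ℤ√d) ∣ z ^ ((p : ℤ) - legendreSym p d).toNat - x from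
    mem_conductorOrder_iff_exists_dvd_sub.2 (by exact_mod_cast this)
  by_cases hd : (d : ZMod p) = 0
  · rw [(legendreSym.eq_zero_iff p d).2 hd, zero_mul, ← intCast_val] at hfrob
    rw [(legendreSym.eq_zero_iff p d).2 hd]
    exact ⟨z.re, by simpa using hfrob⟩
  rcases legendreSym.eq_one_or_neg_one p hd with h | h <;> rw [h] at hfrob ⊢
  · rw [one_mul] at hfrob
    have hcop : IsCoprime (p : ℤ√d) z := by
      exact_mod_cast isCoprime_intCast_of_isCoprime_norm hz
    have hexp : ((p : ℤ) - 1).toNat + 1 = p := by have := hp.out.one_lt; omega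
    refine ⟨1, hcop.dvd_of_dvd_mul_right ?_⟩
    rwa [Int.cast_one, sub_one_mul, ← pow_succ, hexp]
  · have hstar : (⟨z.re, -1 * z.im⟩ : ℤ√d) = star z := by ext <;> simp
    have hexp : ((p : ℤ) - -1).toNat = p + 1 := by omega
    rw [hstar] at hfrob
    refine ⟨z.norm, ?_⟩
    rw [hexp, norm_eq_mul_conj, pow_succ, mul_comm z (star z), ← sub_mul]
    exact hfrob.mul_right z

theorem pow_sub_kroneckerPrime_mem_conductorOrder {p : ℕ} (hp : p.Prime) {z : ℤ√d}
    (hz : IsCoprime z.norm p) :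
    z ^ ((p : ℤ) - kroneckerPrime (4 * d) p).toNat ∈ conductorOrder d p := by
  have : Fact p.Prime := ⟨hp⟩
  obtain rfl | hp2 := eq_or_ne p 2
  · rw [kroneckerPrime_four_mul_two]
    exact sq_mem_conductorOrder_two z
  · rw [kroneckerPrime_four_mul hp2]
    exact pow_sub_legendreSym_mem_conductorOrder hp2 hz

theorem pow_phi_mem_conductorOrder {r : ℕ} (hr : r ≠ 0) {z : ℤ√d} (hz : IsCoprime z.norm r) :
    z ^ phi (4 * d) r ∈ conductorOrder d r := by
  rw [mem_conductorOrder, Int.natCast_dvd, Nat.dvd_iff_prime_pow_dvd_dvd]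
  rintro p (_ | k) hp hpk
  · exact one_dvd _
  have hpr : (p : ℤ) ∣ r := Int.natCast_dvd_natCast.2 ((dvd_pow_self p k.succ_ne_zero).trans hpk)
  obtain ⟨q, hq⟩ := dvd_phi_of_prime_pow_dvd (4 * d) hp hr hpk
  have hmod_p := pow_sub_kroneckerPrime_mem_conductorOrder hp (hz.of_isCoprime_of_dvd_right hpr)
  have hmod_pk := pow_mem (pow_pow_mem_conductorOrder hmod_p k) q
  rwa [← pow_mul, ← pow_mul, ← mul_assoc, mul_comm _ (p ^ k), ← hq, mem_conductorOrder,
    Int.natCast_dvd] at hmod_pk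

end ConductorOrder

section MultiplesMod

/-- The elements of `R` congruent to an integer multiple of `ξ` modulo `r`. -/
def multiplesMod {R : Type*} [CommRing R] (r ξ : R) : Submodule ℤ R :=
  Submodule.span ℤ {ξ} ⊔ (Ideal.span {r}).restrictScalars ℤ

theorem mem_multiplesMod {R : Type*} [CommRing R] {r ξ z : R} :
    z ∈ multiplesMod r ξ ↔ ∃ t : ℤ, r ∣ z - t * ξ := by
  simp only [multiplesMod, Submodule.mem_sup, Submodule.restrictScalars_mem,
    Ideal.mem_span_singleton]
  simp only [Submodule.mem_span_singleton, zsmul_eq_mul]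
  constructor
  · rintro ⟨_, ⟨t, rfl⟩, y, hy, rfl⟩
    exact ⟨t, by rwa [add_sub_cancel_left]⟩
  · rintro ⟨t, ht⟩
    exact ⟨_, ⟨t, rfl⟩, _, ht, add_sub_cancel _ _⟩

theorem multiplesMod_mul_le {R : Type*} [CommRing R] (r ξ ζ : R) :
    multiplesMod r ξ * multiplesMod r ζ ≤ multiplesMod r (ξ * ζ) := by
  refine Submodule.mul_le.2 fun z hz w hw => ?_
  obtain ⟨s, hs⟩ := mem_multiplesMod.1 hz
  obtain ⟨t, ht⟩ := mem_multiplesMod.1 hw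
  refine mem_multiplesMod.2 ⟨s * t, ?_⟩
  have hsplit : z * w - (s * t : ℤ) * (ξ * ζ) = (z - s * ξ) * w + s * ξ * (w - t * ζ) := by
    push_cast
    ring
  rw [hsplit]
  exact dvd_add (hs.mul_right _) (ht.mul_left _)

variable {d : ℤ}

theorem mem_conductorOrder_of_mem_multiplesMod {r : ℤ} {ξ z : ℤ√d} (hξ : ξ ∈ conductorOrder d r)
    (hz : z ∈ multiplesMod (r : ℤ√d) ξ) : z ∈ conductorOrder d r := by
  obtain ⟨t, ht⟩ := mem_multiplesMod.1 hz
  have him := ((intCast_dvd _ _).1 ht).2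
  rw [im_sub, im_smul] at him
  exact (dvd_sub_left (hξ.mul_left t)).1 him

/-- `star α` is invertible modulo `r`, and multiplying by it turns `β ≡ t α` into
`star α * β ≡ t N(α)`. -/
theorem mem_multiplesMod_of_star_mul_mem_conductorOrder {r : ℤ} {α β : ℤ√d}
    (hα : IsCoprime α.norm r) (h : star α * β ∈ conductorOrder d r) :
    β ∈ multiplesMod (r : ℤ√d) α := by
  obtain ⟨c, hc⟩ := mem_conductorOrder_iff_exists_dvd_sub.1 h
  obtain ⟨u, v, huv⟩ := id hα
  have hcop : IsCoprime (r : ℤ√d) (star α) :=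
    isCoprime_intCast_of_isCoprime_norm (by rwa [norm_conj])
  refine mem_multiplesMod.2 ⟨c * u, hcop.dvd_of_dvd_mul_left ?_⟩
  have hbezout : (u * (α * star α) + v * r : ℤ√d) = 1 := by
    rw [← norm_eq_mul_conj]
    exact_mod_cast congrArg (Int.cast : ℤ → ℤ√d) huv
  have hsplit : star α * (β - (c * u : ℤ) * α) = star α * β - c + r * (c * v) := by
    push_cast
    linear_combination (-c : ℤ√d) * hbezout
  rw [hsplit]
  exact dvd_add hc (dvd_mul_right _ _)

end MultiplesMod

namespace BQF

variable {d : ℤ}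

theorem eq_of_disc_eq {f g : BQF} (h0 : f.a ≠ 0) (ha : f.a = g.a) (hb : f.b = g.b)
    (hd : f.disc = g.disc) : f = g := by
  refine BQF.ext ha hb (mul_left_cancel₀ (mul_ne_zero four_ne_zero h0) ?_)
  simp only [disc, ← ha, ← hb] at hd
  linarith

/-- The form `(x, y) ↦ N(x α + y β)` on the lattice spanned by `α` and `β` in `ℤ[√d]`. -/
def normForm (α β : ℤ√d) : BQF := ⟨α.norm, 2 * (star α * β).re, β.norm⟩

theorem disc_normForm (α β : ℤ√d) : (normForm α β).disc = 4 * d * (star α * β).im ^ 2 := by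
  simp only [normForm, disc, norm_def, re_mul, im_mul, re_star, im_star]
  ring

theorem normForm_transform (α β : ℤ√d) (A : Matrix (Fin 2) (Fin 2) ℤ) :
    (normForm α β).transform A =
      normForm (A 0 0 • α + A 1 0 • β) (A 0 1 • α + A 1 1 • β) := by
  ext <;> simp only [normForm, transform, eval, norm_def, zsmul_eq_mul, re_star, im_star, re_add,
    im_add, re_mul, im_mul, re_intCast, im_intCast] <;> ring

theorem im_star_mul_transform (α β : ℤ√d) (A : Matrix (Fin 2) (Fin 2) ℤ) :
    (star (A 0 0 • α + A 1 0 • β) * (A 0 1 • α + A 1 1 • β)).im = (star α * β).im * A.det := by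
  simp only [Matrix.det_fin_two, zsmul_eq_mul, re_star, im_star, re_add, im_add, re_mul, im_mul,
    re_intCast, im_intCast]
  ring

/-- `f` is the norm form of a positively oriented basis of a lattice of index `N` in `ℤ[√d]` that
is contained in `M`. -/
def IsNormForm (f : BQF) (N : ℤ) (M : Submodule ℤ (ℤ√d)) : Prop :=
  ∃ α ∈ M, ∃ β ∈ M, (star α * β).im = N ∧ f = normForm α β

namespace IsNormForm

variable {f g : BQF} {N : ℤ} {M M₁ M₂ : Submodule ℤ (ℤ√d)}

theorem mono (hf : f.IsNormForm N M₁) (h : M₁ ≤ M₂) : f.IsNormForm N M₂ := by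
  obtain ⟨α, hα, β, hβ, hN, rfl⟩ := hf
  exact ⟨α, h hα, β, h hβ, hN, rfl⟩

theorem disc_eq (hf : f.IsNormForm N M) : f.disc = 4 * d * N ^ 2 := by
  obtain ⟨α, -, β, -, rfl, rfl⟩ := hf
  exact disc_normForm α β

theorem transform (hf : f.IsNormForm N M) (A : Matrix (Fin 2) (Fin 2) ℤ) :
    (f.transform A).IsNormForm (N * A.det) M := by
  obtain ⟨α, hα, β, hβ, rfl, rfl⟩ := hf
  exact ⟨_, add_mem (M.smul_mem _ hα) (M.smul_mem _ hβ), _,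
    add_mem (M.smul_mem _ hα) (M.smul_mem _ hβ), im_star_mul_transform α β A,
    normForm_transform α β A⟩

theorem of_b_modEq (hf : f.IsNormForm N M) (h0 : f.a ≠ 0) (ha : f.a = g.a)
    (hb : g.b ≡ f.b [ZMOD 2 * f.a]) (hd : f.disc = g.disc) : g.IsNormForm N M := by
  obtain ⟨t, ht⟩ := hb.symm.dvd
  have htrans : f.transform !![1, t; 0, 1] = g := by
    refine eq_of_disc_eq ?_ ?_ ?_ ?_
    · simpa [BQF.transform, eval] using h0
    · simpa [BQF.transform, eval] using ha
    · simp only [BQF.transform, Matrix.of_apply, Matrix.cons_val', Matrix.cons_val_zero,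
        Matrix.cons_val_fin_one, Matrix.cons_val_one, mul_one, mul_zero, add_zero]
      linarith
    · simpa [disc_transform] using hd
  simpa [htrans] using hf.transform !![1, t; 0, 1]

end IsNormForm

theorem mul_self_add_norm (ω : ℤ√d) : ω * ω + (ω.norm : ℤ√d) = ((2 * ω.re : ℤ) : ℤ√d) * ω := by
  ext <;> simp only [norm_def, re_add, im_add, re_mul, im_mul, re_intCast, im_intCast] <;> ring

/-- Bézout coefficients for `gcd(a₁, a₂, B) = 1` turn `ω ∈ L₁ ∩ L₂` into an element of the product
lattice `L₁ L₂`. -/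
theorem exists_mem_mul_star_mul_eq {a₁ a₂ C : ℤ} {ω α₁ β₁ α₂ β₂ : ℤ√d}
    {M₁ M₂ : Submodule ℤ (ℤ√d)} (hα₁ : α₁ ∈ M₁) (hβ₁ : β₁ ∈ M₁) (hα₂ : α₂ ∈ M₂) (hβ₂ : β₂ ∈ M₂)
    (hω₁ : star α₁ * β₁ = ω) (hω₂ : star α₂ * β₂ = ω) (ha₁ : α₁.norm = a₁) (ha₂ : α₂.norm = a₂)
    (hω : ω.norm = a₁ * a₂ * C) (hcop : ∃ u v w : ℤ, u * a₁ + v * a₂ + w * (2 * ω.re) = 1) :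
    ∃ γ ∈ M₁ * M₂, star (α₁ * α₂) * γ = ω := by
  obtain ⟨u, v, w, huvw⟩ := hcop
  refine ⟨u • (α₁ * β₂) + v • (β₁ * α₂) + w • (β₁ * β₂ + C • (α₁ * α₂)), ?_, ?_⟩
  · have hmul {z₁ z₂ : ℤ√d} (h₁ : z₁ ∈ M₁) (h₂ : z₂ ∈ M₂) := Submodule.mul_mem_mul h₁ h₂
    exact add_mem (add_mem (Submodule.smul_mem _ u (hmul hα₁ hβ₂))
      (Submodule.smul_mem _ v (hmul hβ₁ hα₂))) (Submodule.smul_mem _ w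
        (add_mem (hmul hβ₁ hβ₂) (Submodule.smul_mem _ C (hmul hα₁ hα₂))))
  · have hn₁ : α₁ * star α₁ = (a₁ : ℤ√d) := by rw [← norm_eq_mul_conj, ha₁]
    have hn₂ : α₂ * star α₂ = (a₂ : ℤ√d) := by rw [← norm_eq_mul_conj, ha₂]
    have hsq := mul_self_add_norm ω
    rw [hω] at hsq
    have hbezout := congrArg (Int.cast : ℤ → ℤ√d) huvw
    push_cast at hsq hbezout
    simp only [zsmul_eq_mul]
    calc star (α₁ * α₂) * (u * (α₁ * β₂) + v * (β₁ * α₂) + w * (β₁ * β₂ + C * (α₁ * α₂)))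
        = u * (α₁ * star α₁) * (star α₂ * β₂) + v * (star α₁ * β₁) * (α₂ * star α₂) +
          w * ((star α₁ * β₁) * (star α₂ * β₂) + C * ((α₁ * star α₁) * (α₂ * star α₂))) := by
          rw [star_mul]
          ring
      _ = u * a₁ * ω + v * ω * a₂ + w * (ω * ω + a₁ * a₂ * C) := by
          rw [hω₁, hω₂, hn₁, hn₂]
          ring
      _ = (u * a₁ + v * a₂ + w * (2 * ω.re)) * ω := by
          rw [hsq]
          ring
      _ = ω := by rw [hbezout, one_mul]

theorem IsNormForm.mul_of_concordant {a₁ a₂ B C N : ℤ} {M₁ M₂ : Submodule ℤ (ℤ√d)}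
    (h₁ : (BQF.mk a₁ B (a₂ * C)).IsNormForm N M₁) (h₂ : (BQF.mk a₂ B (a₁ * C)).IsNormForm N M₂)
    (h0 : a₁ * a₂ ≠ 0) (hcop : ∃ u v w : ℤ, u * a₁ + v * a₂ + w * B = 1) :
    (BQF.mk (a₁ * a₂) B C).IsNormForm N (M₁ * M₂) := by
  have hdisc := h₁.disc_eq
  obtain ⟨α₁, hα₁, β₁, hβ₁, hN₁, hf₁⟩ := h₁
  obtain ⟨α₂, hα₂, β₂, hβ₂, hN₂, hf₂⟩ := h₂
  obtain ⟨ha₁, hB₁, hc₁⟩ := BQF.mk.inj hf₁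
  obtain ⟨ha₂, hB₂, -⟩ := BQF.mk.inj hf₂
  have hω : star α₂ * β₂ = star α₁ * β₁ := Zsqrtd.ext (by linarith) (hN₂.trans hN₁.symm)
  obtain ⟨γ, hγ, hγω⟩ := exists_mem_mul_star_mul_eq (C := C) hα₁ hβ₁ hα₂ hβ₂ rfl hω ha₁.symm
    ha₂.symm (by rw [norm_mul, norm_conj, ← ha₁, ← hc₁, mul_assoc]) (by rwa [← hB₁])
  refine ⟨α₁ * α₂, Submodule.mul_mem_mul hα₁ hα₂, γ, hγ, by rw [hγω, hN₁],
    eq_of_disc_eq h0 ?_ ?_ ?_⟩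
  · rw [normForm, norm_mul, ← ha₁, ← ha₂]
  · rw [normForm, hγω, ← hB₁]
  · rw [disc_normForm, hγω, hN₁, ← hdisc]
    simp only [disc]
    ring

theorem isNormForm_top_one_iff {f : BQF} {N : ℤ} :
    f.IsNormForm N (⊤ : Submodule ℤ (ℤ√d)) ↔
      ∃ A : Matrix (Fin 2) (Fin 2) ℤ, A.det = N ∧ f = (BQF.mk 1 0 (-d)).transform A := by
  have hone : BQF.mk 1 0 (-d) = normForm 1 (sqrtd : ℤ√d) := by
    ext <;> simp [normForm, norm_def]
  constructor
  · rintro ⟨α, -, β, -, rfl, rfl⟩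
    refine ⟨!![α.re, β.re; α.im, β.im], ?_, ?_⟩
    · rw [Matrix.det_fin_two_of, im_mul, re_star, im_star]
      ring
    · rw [hone, normForm_transform]
      congr 1 <;> ext <;> simp
  · rintro ⟨A, rfl, rfl⟩
    have := IsNormForm.transform ⟨1, Submodule.mem_top, sqrtd, Submodule.mem_top, rfl, hone⟩ A
    simpa using this

/-- The order of conductor `r` in `ℤ[√d]` is a copy of `ℤ[√(d r²)]`, in which indices shrink by the
factor `r`. -/
theorem IsNormForm.of_le_conductorOrder {f : BQF} {N r d' : ℤ} {M : Submodule ℤ (ℤ√d)}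
    (hf : f.IsNormForm (N * r) M) (hM : ∀ z ∈ M, z ∈ conductorOrder d r) (hr : r ≠ 0)
    (hd : d' = d * r ^ 2) : f.IsNormForm N (⊤ : Submodule ℤ (ℤ√d')) := by
  obtain ⟨α, hα, β, hβ, hN, rfl⟩ := hf
  obtain ⟨s, hs⟩ := hM α hα
  obtain ⟨t, ht⟩ := hM β hβ
  refine ⟨⟨α.re, s⟩, Submodule.mem_top, ⟨β.re, t⟩, Submodule.mem_top, mul_right_cancel₀ hr ?_, ?_⟩
  · rw [← hN]
    simp only [im_mul, re_star, im_star, hs, ht]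
    ring
  · ext <;> simp only [normForm, norm_def, re_mul, re_star, im_star, hs, ht, hd] <;> ring

end BQF

namespace PForm

variable {D : ℤ}

theorem exists_equiv_isCoprime_a (f : PForm D) {M : ℤ} (hM : M ≠ 0) :
    ∃ g : PForm D, g ≈ f ∧ IsCoprime g.1.a M := by
  obtain ⟨x, y, hxy, hcop⟩ := f.2.2.1.exists_coprime M hM
  obtain ⟨S, rfl, rfl⟩ := hxy.exists_SL2_col 0
  exact ⟨⟨f.1.transform S.1, by rw [BQF.disc_transform, S.2, f.2.1, one_pow, mul_one],
    f.2.2.1.transform S, f.2.2.2.transform S⟩, ⟨S, rfl⟩, hcop⟩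

theorem IsDirichletComposition.exists_bezout {f g k : PForm D} (h : IsDirichletComposition f g k) :
    ∃ u v w : ℤ, u * f.1.a + v * g.1.a + w * k.1.b = 1 := by
  obtain ⟨hgcd, -, hkf, hkg⟩ := h
  obtain ⟨t₁, ht₁⟩ := hkf.symm.dvd
  obtain ⟨t₂, ht₂⟩ := hkg.symm.dvd
  have hhalf : (f.1.b + g.1.b) / 2 = k.1.b - f.1.a * t₁ - g.1.a * t₂ := by
    rw [show f.1.b + g.1.b = 2 * (k.1.b - f.1.a * t₁ - g.1.a * t₂) by linarith,
      Int.mul_ediv_cancel_left _ two_ne_zero]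
  obtain ⟨x, y, hxy⟩ := Int.isCoprime_iff_gcd_eq_one.2 hgcd
  rw [Int.gcd_eq_gcd_ab g.1.a, hhalf] at hxy
  set p := Int.gcdA g.1.a (k.1.b - f.1.a * t₁ - g.1.a * t₂)
  set q := Int.gcdB g.1.a (k.1.b - f.1.a * t₁ - g.1.a * t₂)
  exact ⟨x - y * q * t₁, y * p - y * q * t₂, y * q, by linear_combination hxy⟩

theorem IsDirichletComposition.isNormForm {d N : ℤ} {M₁ M₂ : Submodule ℤ (ℤ√d)} {f g k : PForm D}
    (h : IsDirichletComposition f g k) (hf : f.1.IsNormForm N M₁) (hg : g.1.IsNormForm N M₂) :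
    k.1.IsNormForm N (M₁ * M₂) := by
  have hcop := h.exists_bezout
  obtain ⟨-, hka, hkf, hkg⟩ := h
  have hfa := f.2.2.2.a_pos.ne'
  have hga := g.2.2.2.a_pos.ne'
  have hf' : (BQF.mk f.1.a k.1.b (g.1.a * k.1.c)).IsNormForm N M₁ := by
    refine hf.of_b_modEq hfa rfl hkf (f.2.1.trans (k.2.1.symm.trans ?_))
    rw [BQF.disc, BQF.disc, hka]
    ring
  have hg' : (BQF.mk g.1.a k.1.b (f.1.a * k.1.c)).IsNormForm N M₂ := by
    refine hg.of_b_modEq hga rfl hkg (g.2.1.trans (k.2.1.symm.trans ?_))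
    rw [BQF.disc, BQF.disc, hka]
    ring
  have hk := hf'.mul_of_concordant hg' (mul_ne_zero hfa hga) hcop
  rwa [← hka] at hk

end PForm

namespace FormClass

variable {D d N : ℤ}

theorem IsDerived.trans {D₁ D₂ D₃ s t : ℤ} {F : FormClass D₁} {G : FormClass D₂} {H : FormClass D₃}
    (hFG : F.IsDerived s G) (hGH : G.IsDerived t H) : F.IsDerived (t * s) H := by
  obtain ⟨f, g, A, hf, hg, rfl, hfg⟩ := hFG
  obtain ⟨g', h, B, hg', hh, rfl, hgh⟩ := hGH
  obtain ⟨S, hS⟩ : g ≈ g' := Quotient.exact (hg.trans hg'.symm)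
  refine ⟨f, h, B * (S.1 * A), hf, hh, ?_, ?_⟩
  · rw [Matrix.det_mul, Matrix.det_mul, S.2, one_mul]
  · rw [hfg, hS, hgh, BQF.transform_mul, BQF.transform_mul]

/-- Some form in the class `F` is the norm form of a positively oriented basis of a lattice of index
`N` in `ℤ[√d]` that is contained in `M`. -/
def IsNormClass (F : FormClass D) (N : ℤ) (M : Submodule ℤ (ℤ√d)) : Prop :=
  ∃ f : PForm D, mk f = F ∧ f.1.IsNormForm N M

theorem isNormClass_mk {f : PForm D} {M : Submodule ℤ (ℤ√d)} :
    (mk f).IsNormClass N M ↔ f.1.IsNormForm N M := by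
  refine ⟨?_, fun h => ⟨f, rfl, h⟩⟩
  rintro ⟨g, hgf, hg⟩
  obtain ⟨S, hS⟩ : f ≈ g := Quotient.exact hgf.symm
  simpa [hS] using hg.transform S.1

theorem isDerived_e_iff {m : ℕ+} {F : FormClass D} :
    F.IsDerived N (e m) ↔ F.IsNormClass N (⊤ : Submodule ℤ (ℤ√(-(m : ℤ)))) := by
  simp only [IsNormClass, BQF.isNormForm_top_one_iff, neg_neg]
  constructor
  · rintro ⟨f, g, A, hf, hg, rfl, hfg⟩
    obtain ⟨S, hS⟩ : g ≈ _ := Quotient.exact hg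
    refine ⟨f, hf, S.1 * A, by rw [Matrix.det_mul, S.2, one_mul], ?_⟩
    rw [hfg, hS, BQF.transform_mul]
  · rintro ⟨f, hf, A, hA, hfA⟩
    exact ⟨f, _, A, hf, rfl, hA, hfA⟩

namespace IsNormClass

theorem mono {F : FormClass D} {M₁ M₂ : Submodule ℤ (ℤ√d)} (hF : F.IsNormClass N M₁)
    (h : M₁ ≤ M₂) : F.IsNormClass N M₂ := by
  obtain ⟨f, hf, hfN⟩ := hF
  exact ⟨f, hf, hfN.mono h⟩

theorem mul {F G : FormClass D} {M₁ M₂ : Submodule ℤ (ℤ√d)} (hF : F.IsNormClass N M₁)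
    (hG : G.IsNormClass N M₂) : (F * G).IsNormClass N (M₁ * M₂) := by
  obtain ⟨f, g, k, rfl, rfl, hk, hfgk⟩ := mul_isComposition F G
  exact ⟨k, hk, hfgk.isNormForm (isNormClass_mk.1 hF) (isNormClass_mk.1 hG)⟩

theorem e_of_sqrtd_mem {m : ℕ+} {M : Submodule ℤ (ℤ√d)} (hm : (m : ℤ) = -d * N ^ 2)
    (hone : 1 ∈ M) (hsqrtd : (N : ℤ√d) * sqrtd ∈ M) : (e m).IsNormClass N M := by
  refine isNormClass_mk.2 ⟨1, hone, _, hsqrtd, by simp, ?_⟩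
  ext <;> simp [BQF.normForm, norm_def, hm, sq, mul_assoc]

theorem pow {m : ℕ+} {r : ℤ} {ξ : ℤ√d} {F : FormClass (-4 * (m : ℤ))} (hr : r ∣ N)
    (hF : F.IsNormClass N (multiplesMod (r : ℤ√d) ξ)) (k : ℕ) :
    (F.pow k).IsNormClass N (multiplesMod (r : ℤ√d) (ξ ^ k)) := by
  induction k with
  | zero =>
    obtain ⟨f, -, hf⟩ := hF
    have hm : (m : ℤ) = -d * N ^ 2 := by linarith [hf.disc_eq, f.2.1]
    refine e_of_sqrtd_mem hm (mem_multiplesMod.2 ⟨1, by simp⟩) (mem_multiplesMod.2 ⟨0, ?_⟩)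
    simpa using ((intCast_dvd_intCast r N).2 hr).mul_right sqrtd
  | succ k ih =>
    rw [pow_succ]
    exact (ih.mul hF).mono (multiplesMod_mul_le _ _ _)

theorem exists_multiplesMod {r : ℤ} {M : Submodule ℤ (ℤ√d)} {F : FormClass D} (hr : r ≠ 0)
    (hrN : r ∣ N) (hF : F.IsNormClass N M) :
    ∃ ξ : ℤ√d, IsCoprime ξ.norm r ∧ F.IsNormClass N (multiplesMod (r : ℤ√d) ξ) := by
  obtain ⟨f, rfl, -⟩ := id hF
  obtain ⟨f', hff', hcop⟩ := f.exists_equiv_isCoprime_a hr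
  rw [show mk f = mk f' from (Quotient.sound hff').symm, isNormClass_mk] at hF
  obtain ⟨α, -, β, -, hN, hf'⟩ := hF
  have hα : IsCoprime α.norm r := by rwa [hf'] at hcop
  have hβ : β ∈ multiplesMod (r : ℤ√d) α :=
    mem_multiplesMod_of_star_mul_mem_conductorOrder hα (mem_conductorOrder.2 (hN ▸ hrN))
  exact ⟨α, hα, f', Quotient.sound hff', α, mem_multiplesMod.2 ⟨1, by simp⟩, β, hβ, hN, hf'⟩

theorem of_le_conductorOrder {r d' : ℤ} {M : Submodule ℤ (ℤ√d)} {F : FormClass D}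
    (hF : F.IsNormClass (N * r) M) (hM : ∀ z ∈ M, z ∈ conductorOrder d r) (hr : r ≠ 0)
    (hd : d' = d * r ^ 2) : F.IsNormClass N (⊤ : Submodule ℤ (ℤ√d')) := by
  obtain ⟨f, hf, hfN⟩ := hF
  exact ⟨f, hf, hfN.of_le_conductorOrder hM hr hd⟩

end IsNormClass

end FormClass

theorem mainTheorem4_general (a : ℤ) (b r m : ℕ+) (h : FormClass (-4 * (m : ℤ)))
    (hh : h.IsDerived (a * r) (FormClass.e b)) :
    (h.pow (phi (-4 * (b : ℤ)) r)).IsDerived (a * r) (FormClass.e b) ∧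
      (h.pow (phi (-4 * (b : ℤ)) r)).IsDerived a (FormClass.e (b * r ^ 2)) := by
  have hr : (r : ℤ) ≠ 0 := by simp
  have hrN : (r : ℤ) ∣ a * r := dvd_mul_left _ _
  obtain ⟨ξ, hξ, hF⟩ := (FormClass.isDerived_e_iff.1 hh).exists_multiplesMod hr hrN
  have hpow := hF.pow hrN (phi (-4 * (b : ℤ)) r)
  have hξ_mem : ξ ^ phi (-4 * (b : ℤ)) r ∈ conductorOrder (-(b : ℤ)) r := by
    rw [neg_mul_comm]
    exact pow_phi_mem_conductorOrder r.ne_zero hξ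
  refine ⟨FormClass.isDerived_e_iff.2 (hpow.mono le_top), FormClass.isDerived_e_iff.2 ?_⟩
  refine hpow.of_le_conductorOrder (fun z => mem_conductorOrder_of_mem_multiplesMod hξ_mem) hr ?_
  push_cast
  ring

theorem mainTheorem4 (a b n r : ℕ+) (hn : n = a ^ 2 * b) (hr : Nat.Coprime (r : ℕ) (a : ℕ))
    (g : FormClass (-4 * (n : ℤ))) (hg : g.IsDerived (a : ℤ) (FormClass.e b))
    (h : FormClass (-4 * ((n * r ^ 2 : ℕ+) : ℤ))) (hh : h.IsDerived (r : ℤ) g) :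
    (h.pow (phi (-4 * (n : ℤ)) (r : ℕ))).IsDerived ((a * r : ℕ+) : ℤ) (FormClass.e b) ∧
      (h.pow (phi (-4 * (n : ℤ)) (r : ℕ))).IsDerived (a : ℤ) (FormClass.e (b * r ^ 2)) := by
  have hn' : -4 * (n : ℤ) = (a : ℤ) ^ 2 * (-4 * b) := by
    rw [hn]
    push_cast
    ring
  have hφ : phi (-4 * (n : ℤ)) r = phi (-4 * (b : ℤ)) r := by
    rw [hn', phi_sq_mul (Nat.isCoprime_iff_coprime.2 hr.symm)]
  rw [hφ, show ((a * r : ℕ+) : ℤ) = a * r by simp]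
  exact mainTheorem4_general a b r _ h (hh.trans hg)
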